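/- **Setting.** Let $V(z)=a_0z^N+\cdots$ be a complex polynomial of degree $N\ge 2$ and let $\varphi=\operatorname{Re}V$. *Energy.* For a closed set $F\subset\mathbb C$ let $\mathcal M_1^\varphi(F)$ be the set of Borel probability measures $\mu$ supported on $F$ such that $\int\log(1+|x|)\,d\mu(x)<\infty$, the logarithmic energy $I(\mu)=\iint\log\frac1{|x-y|}\,d\mu(x)\,d\mu(y)$ is finite, and $\varphi\in L^1(\mu)$. Put $$I^\varphi(F)=\inf_{\mu\in\mathcal M_1^\varphi(F)}\Big(I(\mu)+\int\varphi\,d\mu\Big)\in[-\infty,+\infty].$$ *Sectors.* For $j=1,\dots,N$ let $\theta_j=-\frac{\arg a_0}{N}+\frac{2\pi(j-1)}{N}$ and $S_j=\{z\ne 0: |\arg z-\theta_j|<\frac{\pi}{2N}\}$ (arguments modulo $2\pi$). A set $F\subset\mathbb C$ stretches out to infinity in $S_j$ if there are $\epsilon>0$ and $r_0>0$ such that for every $r>r_0$ there is $z\in F$ with $|z|=r$ and $|\arg z-\theta_j|<\frac{\pi}{2N}-\epsilon$. *Admissible contours.* Let $\mathcal P$ be a noncrossing partition of $\{1,\dots,N\}$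 (if $j<k<j'<k'$, with $j,j'$ in one block and $k,k'$ in one block, then the two blocks coincide), and let $\mathcal P_0$ be the set of its non-singleton blocks, assumed nonempty. Let $\mathcal T=\mathcal T(\mathcal P)$ be the collection of all $\Gamma\subset\mathbb C$ such that 1. $\Gamma$ is a finite union of $C^1$ Jordan arcs (closed in $\mathbb C$; ends at infinity are allowed); 2. $\Gamma$ has at most $|\mathcal P_0|$ connected components, each of them unbounded and stretching out to infinity in at least two of the sectors $S_1,\dots,S_N$; 3. for each $A\in\mathcal P_0$ some connected component of $\Gamma$ stretches out to infinity in $S_j$ for every $j\in A$; 4. for each singleton block $\{j\}\in\mathcal P$ there is $R>0$ such that $\Gamma\cap\{z\in S_j:|z|\ge R\}=\emptyset$. *The restricted classes.* For $M>0$ let $$\Delta_M=\{z\in\mathbb C:\varphi(z)<-M,\ \operatorname{dist}(z,\varphi^{-1}(-M))>8\},\qquad \mathcal T_M=\{\Gamma\in\mathcal T:\Gamma\cap\Delta_M=\emptyset\},$$ where $\operatorname{dist}$ is the Euclidean distance. Let $\mathcal F_M$ be the closure of $\mathcal T_M$ among the closed subsets of $\mathbb C$ in the Hausdorff metric induced by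 the distance $\frac{|z-w|}{\sqrt{1+|z|^2}\sqrt{1+|w|^2}}$ of the Riemann sphere, where the point $\infty$ is added to every unbounded closed set. **Proposition 5.1.** One has $\sup_{\Gamma\in\mathcal T}I^\varphi(\Gamma)>-\infty$, and for every $M>0$ with $-M<\sup_{\Gamma\in\mathcal T}I^\varphi(\Gamma)$ (hence for all sufficiently large $M$), $$\sup_{\Gamma\in\mathcal T\setminus\mathcal T_M}I^\varphi(\Gamma)<\sup_{\Gamma\in\mathcal T_M}I^\varphi(\Gamma)\le\sup_{F\in\mathcal F_M}I^\varphi(F)<+\infty,$$ where the supremum over the empty collection is $-\infty$. -/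

import Mathlib

open scoped ENNReal

noncomputable section

namespace SCurve

open MeasureTheory Polynomial

/-! ### Weighted logarithmic energy -/

/-- The external field `φ = Re V`. -/
def field (V : ℂ[X]) (z : ℂ) : ℝ := (V.eval z).re

/-- Positive part of the kernel `log (1 / |x - y|)`; it is `+∞` on the diagonal. -/
def logKernelPos (x y : ℂ) : ℝ≥0∞ :=
  if x = y then ⊤ else ENNReal.ofReal (Real.log (1 / ‖x - y‖))

/-- Negative part of the kernel `log (1 / |x - y|)`; it is `0` on the diagonal. -/
def logKernelNeg (x y : ℂ) : ℝ≥0∞ :=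
  if x = y then 0 else ENNReal.ofReal (-Real.log (1 / ‖x - y‖))

/-- Logarithmic energy `I(μ) = ∬ log (1 / |x - y|) dμ(x) dμ(y)`, as the integral of the positive part
minus the integral of the negative part. Under the growth condition in `MOne` the latter is finite,
so that `I(μ)` is a well defined element of `(-∞, +∞]`. -/
def logEnergy (μ : Measure ℂ) : EReal :=
  ((∫⁻ x, ∫⁻ y, logKernelPos x y ∂μ ∂μ : ℝ≥0∞) : EReal) -
    ((∫⁻ x, ∫⁻ y, logKernelNeg x y ∂μ ∂μ : ℝ≥0∞) : EReal)

/-- `M₁(F)`: Borel probability measures `μ` supported on the closed set `F` with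
`∫ log (1 + |x|) dμ(x) < ∞`. -/
def MOne (F : Set ℂ) : Set (Measure ℂ) :=
  {μ | IsProbabilityMeasure μ ∧ μ Fᶜ = 0 ∧ Integrable (fun x : ℂ => Real.log (1 + ‖x‖)) μ}

/-- `M₁^φ(F)`: the measures in `M₁(F)` with finite logarithmic energy and with `φ ∈ L¹(μ)`. -/
def MOneField (V : ℂ[X]) (F : Set ℂ) : Set (Measure ℂ) :=
  {μ | μ ∈ MOne F ∧ logEnergy μ ≠ ⊤ ∧ logEnergy μ ≠ ⊥ ∧ Integrable (field V) μ}

/-- `I^φ(μ) = I(μ) + ∫ φ dμ`, for `μ ∈ M₁^φ(F)`. -/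
def weightedEnergy (V : ℂ[X]) (μ : Measure ℂ) : EReal :=
  logEnergy μ + ((∫ x, field V x ∂μ : ℝ) : EReal)

/-- `I^φ(F) = inf { I^φ(μ) : μ ∈ M₁^φ(F) }`, an element of `[-∞, +∞]`. -/
def setEnergy (V : ℂ[X]) (F : Set ℂ) : EReal :=
  ⨅ μ ∈ MOneField V F, weightedEnergy V μ

/-! ### Sectors and admissible contours -/

/-- The central angle `θ_j` of the `j`-th sector; here `j` runs over `0, …, N - 1`. -/
def sectorAngle (V : ℂ[X]) (j : Fin V.natDegree) : ℝ :=
  -(V.leadingCoeff.arg) / V.natDegree + 2 * Real.pi * (j : ℕ) / V.natDegree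

/-- The open sector `|arg z - θ| < α` with vertex `0` (arguments are taken modulo `2π`; the
argument of `z e^{-iθ}` is the representative of `arg z - θ` in `(-π, π]`). -/
def openSector (θ α : ℝ) : Set ℂ :=
  {z | z ≠ 0 ∧ |(z * Complex.exp (-(θ : ℂ) * Complex.I)).arg| < α}

/-- The sector `S_j`. -/
def sector (V : ℂ[X]) (j : Fin V.natDegree) : Set ℂ :=
  openSector (sectorAngle V j) (Real.pi / (2 * V.natDegree))

/-- `F` stretches out to infinity in the sector `S_j`. -/
def StretchesOut (V : ℂ[X]) (F : Set ℂ) (j : Fin V.natDegree) : Prop :=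
  ∃ ε > (0 : ℝ), ∃ r₀ > (0 : ℝ), ∀ r > r₀, ∃ z ∈ F,
    ‖z‖ = r ∧ z ∈ openSector (sectorAngle V j) (Real.pi / (2 * V.natDegree) - ε)

/-- A `C¹` Jordan arc in the plane, possibly with one or both ends at infinity: the image of a
nondegenerate closed interval `I` of the real line (bounded or not) under an injective `C¹` map
with nonvanishing derivative that tends to infinity along every infinite end of `I`. -/
def IsC1JordanArc (C : Set ℂ) : Prop :=
  ∃ (I : Set ℝ) (γ : ℝ → ℂ), IsClosed I ∧ I.OrdConnected ∧ I.Nontrivial ∧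
    ContDiffOn ℝ 1 γ I ∧ (∀ t ∈ I, derivWithin γ I t ≠ 0) ∧ Set.InjOn γ I ∧
    Filter.Tendsto γ (Filter.cocompact ℝ ⊓ Filter.principal I) (Filter.cocompact ℂ) ∧
    C = γ '' I

/-- The connected components of a subset of the plane. -/
def components (Γ : Set ℂ) : Set (Set ℂ) := {C | ∃ x ∈ Γ, C = connectedComponentIn Γ x}

/-- A partition of the index set is noncrossing. -/
def IsNoncrossing {N : ℕ} (P : Finpartition (Finset.univ : Finset (Fin N))) : Prop :=
  ∀ A ∈ P.parts, ∀ B ∈ P.parts, ∀ j ∈ A, ∀ k ∈ B, ∀ j' ∈ A, ∀ k' ∈ B,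
    j < k → k < j' → j' < k' → A = B

/-- `P₀`: the blocks of `P` that are not singletons. -/
def nonSingletons {N : ℕ} (P : Finpartition (Finset.univ : Finset (Fin N))) :
    Finset (Finset (Fin N)) :=
  P.parts.filter fun A => A.card ≠ 1

/-- `Γ` is an admissible contour for the polynomial `V` and the partition `P`. -/
structure IsAdmissible (V : ℂ[X])
    (P : Finpartition (Finset.univ : Finset (Fin V.natDegree))) (Γ : Set ℂ) : Prop where
  finite_union : ∃ 𝒞 : Set (Set ℂ), 𝒞.Finite ∧ (∀ C ∈ 𝒞, IsC1JordanArc C) ∧ Γ = ⋃₀ 𝒞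
  card_components : (components Γ).encard ≤ (nonSingletons P).card
  unbounded : ∀ C ∈ components Γ, ¬ Bornology.IsBounded C
  two_sectors : ∀ C ∈ components Γ, ∃ j k, j ≠ k ∧ StretchesOut V C j ∧ StretchesOut V C k
  blocks : ∀ A ∈ nonSingletons P, ∃ C ∈ components Γ, ∀ j ∈ A, StretchesOut V C j
  singletons : ∀ A ∈ P.parts, A ∉ nonSingletons P →
    ∃ R > (0 : ℝ), ∀ j ∈ A, Γ ∩ (sector V j \ Metric.ball 0 R) = ∅

/-- The collection `𝒯 = 𝒯(P)` of admissible contours. -/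
def contours (V : ℂ[X]) (P : Finpartition (Finset.univ : Finset (Fin V.natDegree))) :
    Set (Set ℂ) :=
  {Γ | IsAdmissible V P Γ}

/-! ### The forbidden region and the restricted classes -/

/-- `Δ_M`: the points with `φ < -M` at Euclidean distance `> 8` from the level set `φ = -M`. -/
def forbidden (V : ℂ[X]) (M : ℝ) : Set ℂ :=
  {z | field V z < -M ∧ 8 < Metric.infDist z {w | field V w = -M}}

/-- `𝒯_M`: the admissible contours that avoid `Δ_M`. -/
def contoursM (V : ℂ[X]) (P : Finpartition (Finset.univ : Finset (Fin V.natDegree))) (M : ℝ) :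
    Set (Set ℂ) :=
  {Γ | Γ ∈ contours V P ∧ Γ ∩ forbidden V M = ∅}

/-- The inverse stereographic map of the extended plane onto the sphere with centre `(0, 0, 1/2)`
and radius `1/2`. -/
def stereo (p : OnePoint ℂ) : EuclideanSpace ℝ (Fin 3) :=
  p.elim !₂[0, 0, 1]
    fun z : ℂ => !₂[z.re / (1 + ‖z‖ ^ 2), z.im / (1 + ‖z‖ ^ 2), ‖z‖ ^ 2 / (1 + ‖z‖ ^ 2)]

/-- A closed subset of the plane as a closed subset of the extended plane: the point at infinity is
added exactly when the set is unbounded. -/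
def addInfty (F : Set ℂ) : Set (OnePoint ℂ) :=
  (fun z : ℂ => (z : OnePoint ℂ)) '' F ∪ {p | p = OnePoint.infty ∧ ¬ Bornology.IsBounded F}

/-- Hausdorff distance of closed subsets of the plane with respect to the chordal distance
`|L(z) - L(w)|` of the extended plane (it is `⊤` between the empty set and a nonempty one). -/
def sphereHausdorff (F G : Set ℂ) : ℝ≥0∞ :=
  Metric.hausdorffEDist (stereo '' addInfty F) (stereo '' addInfty G)

/-- `ℱ_M`: the closure of `𝒯_M` among the closed subsets of the plane, in the Hausdorff metric. -/
def closureM (V : ℂ[X]) (P : Finpartition (Finset.univ : Finset (Fin V.natDegree))) (M : ℝ) :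
    Set (Set ℂ) :=
  {F | IsClosed F ∧ ∀ ε > (0 : ℝ≥0∞), ∃ Γ ∈ contoursM V P M, sphereHausdorff F Γ < ε}

end SCurve

end

noncomputable section

namespace SCurve

open MeasureTheory Polynomial

/-! ### Measurable sections and transport of measures -/

/-! The engine is one test measure. If a closed set meets every circle of radius `r ∈ [a, a + 8]`
about a point `c`, lift the uniform distribution of radii to the set by a measurable selection. By
the reverse triangle inequality its logarithmic kernel is dominated by that of the radii. For
uniform radii on an interval of length 8 the energy is at most zero, so the weighted energy of the
set is at most the maximum of `φ` on the disc of radius `a + 8` (`setEnergy_le_of_circles`).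

A contour that enters `Δ_M` at `z` has an unbounded component through `z`, so it meets all circles
about `z` of radius at most 8. On that disc `φ ≤ -M`, because the level set `φ = -M` is farther
away, and hence its energy is at most `-M`. If the supremum over `𝒯` exceeds `-M`, some contour has
energy above `-M`. It must avoid `Δ_M`, which gives the strict inequality.

For finiteness over `ℱ_M`: far out, the rays where `a₀ z ^ N` is nonpositive lie in `Δ_M` and
separate the sectors. A component of a contour in `𝒯_M` that reaches two sectors must therefore
enter a fixed disc, and so it meets every larger circle. This property survives Hausdorff limits,
and the test measure applies about `0`.

The supremum over `𝒯` is not `-∞`, because on a star of central rays `φ` dominates `2 log (1 +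
|z|)`, which absorbs the negative part of the kernel. -/

/-- A continuous real function on the Cantor set has a measurable section over its range. -/
theorem exists_measurable_section_cantorSet (h : cantorSet → ℝ) (hh : Continuous h) :
    ∃ σ : ℝ → cantorSet, Measurable σ ∧ ∀ r ∈ Set.range h, h (σ r) = r := by
  classical
  let t₁ : cantorSet := ⟨0, zero_mem_cantorSet⟩
  have : Nonempty cantorSet := ⟨t₁⟩
  have : CompactSpace cantorSet := isCompact_iff_compactSpace.mp isCompact_cantorSet
  -- Selecting the least point of each compact fibre makes the selection measurable: the fibres
  -- whose least point is `≤ c` are exactly those over the compact set `h '' {t ≤ c}`.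
  have hmin : ∀ r ∈ Set.range h, ∃ t : cantorSet, h t = r ∧ ∀ t', h t' = r → (t : ℝ) ≤ t' := by
    rintro r ⟨t₀, ht₀⟩
    have hc : IsCompact (h ⁻¹' {r}) := (isClosed_singleton.preimage hh).isCompact
    obtain ⟨t, ht, hmin⟩ := hc.exists_isMinOn ⟨t₀, ht₀⟩ continuous_subtype_val.continuousOn
    exact ⟨t, ht, fun t' ht' => hmin ht'⟩
  choose! m hm hm' using hmin
  have hR : IsClosed (Set.range h) := (isCompact_range hh).isClosed
  refine ⟨fun r => if r ∈ Set.range h then m r else t₁, ?_,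
    fun r hr => by simp only [if_pos hr, hm r hr]⟩
  rw [← (MeasurableEmbedding.subtype_coe isClosed_cantorSet.measurableSet).measurable_comp_iff]
  refine measurable_of_Iic fun c => ?_
  have hK : IsClosed (h '' {t | (t : ℝ) ≤ c}) :=
    ((isClosed_Iic.preimage continuous_subtype_val).isCompact.image hh).isClosed
  have : ((fun t : cantorSet => (t : ℝ)) ∘ fun r => if r ∈ Set.range h then m r else t₁) ⁻¹' Set.Iic c =
      h '' {t | (t : ℝ) ≤ c} ∪ ((Set.range h)ᶜ ∩ {_r | (t₁ : ℝ) ≤ c}) := by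
    ext r
    by_cases hr : r ∈ Set.range h
    · simp only [Set.mem_preimage, Function.comp, Set.mem_Iic, Set.mem_union,
        Set.mem_inter_iff, Set.mem_compl_iff, hr, not_true, false_and, or_false]
      exact ⟨fun h1 => ⟨m r, h1, hm r hr⟩, fun ⟨t, ht, htr⟩ => (hm' r hr t htr).trans ht⟩
    · simp only [Set.mem_preimage, Function.comp, Set.mem_Iic, Set.mem_union,
        Set.mem_inter_iff, Set.mem_compl_iff, hr, not_false_eq_true, true_and, Set.mem_ofPred_eq]
      refine ⟨Or.inr, fun h1 => h1.resolve_left fun ⟨t, _, htr⟩ => hr ⟨t, htr⟩⟩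
  rw [this]
  exact hK.measurableSet.union (hR.measurableSet.compl.inter (MeasurableSet.const _))

/-- A continuous real function on a compact metric space has a measurable section over its range. -/
theorem exists_measurable_section {X : Type*} [Nonempty X] [MetricSpace X] [CompactSpace X]
    [MeasurableSpace X] [BorelSpace X] (f : X → ℝ) (hf : Continuous f) :
    ∃ s : ℝ → X, Measurable s ∧ ∀ r ∈ Set.range f, f (s r) = r := by
  -- Every nonempty compact metric space is a continuous image of the Cantor set, whose order
  -- provides the selection.
  obtain ⟨g, hg, hgs⟩ := exists_nat_bool_continuous_surjective_of_compact X
  have hg' : Continuous (g ∘ cantorSetHomeomorphNatToBool) := hg.comp (Homeomorph.continuous _)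
  have hgs' := hgs.comp cantorSetHomeomorphNatToBool.surjective
  obtain ⟨σ, hσ, hσ'⟩ := exists_measurable_section_cantorSet _ (hf.comp hg')
  refine ⟨_, hg'.measurable.comp hσ, fun r hr => hσ' r ?_⟩
  obtain ⟨x, rfl⟩ := hr
  obtain ⟨t, rfl⟩ := hgs' x
  exact ⟨t, rfl⟩

/-- A probability measure on an interval of radii lifts to any compact set that meets all the
corresponding circles. -/
theorem exists_lift_measure {K : Set ℂ} (hK : IsCompact K) (f : ℂ → ℝ) (hf : Continuous f)
    (ν : Measure ℝ) [IsProbabilityMeasure ν] {S : Set ℝ} (hS : ∀ r ∈ S, ∃ z ∈ K, f z = r)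
    (hν : ∀ᵐ r ∂ν, r ∈ S) :
    ∃ μ : Measure ℂ, IsProbabilityMeasure μ ∧ μ Kᶜ = 0 ∧ μ.map f = ν := by
  have hne : Nonempty K := by
    obtain ⟨r, hr⟩ := hν.exists
    obtain ⟨z, hz, -⟩ := hS r hr
    exact ⟨z, hz⟩
  have : CompactSpace K := isCompact_iff_compactSpace.mp hK
  obtain ⟨s, hs, hsf⟩ := exists_measurable_section (fun x : K => f x)
    (hf.comp continuous_subtype_val)
  have hs' : Measurable fun r => (s r : ℂ) := measurable_subtype_coe.comp hs
  refine ⟨ν.map fun r => (s r : ℂ), Measure.isProbabilityMeasure_map hs'.aemeasurable, ?_, ?_⟩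
  · rw [Measure.map_apply hs' hK.isClosed.measurableSet.compl]
    convert measure_empty (μ := ν)
    ext r
    simp
  · rw [Measure.map_map hf.measurable hs']
    conv_rhs => rw [← Measure.map_id (μ := ν)]
    refine Measure.map_congr ?_
    filter_upwards [hν] with r hr
    obtain ⟨z, hz, hzr⟩ := hS r hr
    exact hsf r ⟨⟨z, hz⟩, hzr⟩

/-! ### The uniform distribution of radii has nonpositive energy -/

/-- The uniform distribution on `[a, a + 8]`. -/
def uniformRadii (a : ℝ) : Measure ℝ := (8 : ℝ≥0∞)⁻¹ • volume.restrict (Set.Icc a (a + 8))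

instance (a : ℝ) : IsProbabilityMeasure (uniformRadii a) := by
  refine ⟨?_⟩
  simp only [uniformRadii, Measure.smul_apply, Measure.restrict_apply MeasurableSet.univ,
    Set.univ_inter, Real.volume_Icc, smul_eq_mul, add_sub_cancel_left]
  rw [ENNReal.ofReal_ofNat]
  exact ENNReal.inv_mul_cancel (by simp) (by simp)

theorem ae_uniformRadii (a : ℝ) : ∀ᵐ r ∂(uniformRadii a), r ∈ Set.Icc a (a + 8) :=
  Measure.ae_smul_measure (ae_restrict_mem measurableSet_Icc) _

/-- The positive part of the one-dimensional logarithmic kernel. -/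
def radialPos (r s : ℝ) : ℝ≥0∞ := if r = s then ⊤ else ENNReal.ofReal (Real.log (1 / |r - s|))

/-- The negative part of the one-dimensional logarithmic kernel, off the diagonal. -/
def radialNeg (r s : ℝ) : ℝ≥0∞ := ENNReal.ofReal (Real.log |r - s|)

theorem measurable_radialPos (r : ℝ) : Measurable (radialPos r) :=
  Measurable.ite (measurableSet_eq_fun measurable_const measurable_id) measurable_const
    (by fun_prop)

theorem measurable_radialNeg (r : ℝ) : Measurable (radialNeg r) := by
  unfold radialNeg; fun_prop

/-- Since `Real.log t = Real.log |t|`, this is the total mass of the positive part of the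
one-dimensional kernel. -/
theorem lintegral_neg_log_abs :
    ∫⁻ t in Set.Icc (-1 : ℝ) 1, ENNReal.ofReal (-Real.log t) = 2 := by
  have hi : IntegrableOn (fun t : ℝ => -Real.log t) (Set.Icc (-1) 1) := by
    rw [integrableOn_Icc_iff_integrableOn_Ioc,
      ← intervalIntegrable_iff_integrableOn_Ioc_of_le (by norm_num)]
    exact intervalIntegral.intervalIntegrable_log'.neg
  rw [← ofReal_integral_eq_lintegral_ofReal hi]
  · rw [integral_Icc_eq_integral_Ioc, ← intervalIntegral.integral_of_le (by norm_num),
      intervalIntegral.integral_neg, integral_log]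
    norm_num
  · filter_upwards [ae_restrict_mem measurableSet_Icc] with t ht
    rw [← Real.log_abs]
    simpa using Real.log_nonpos (abs_nonneg t) (abs_le.2 ht)

/-- The positive part lives on `|r - s| ≤ 1`, where its total mass is 2; the density is `1/8`. The
bound depends on neither `a` nor `r`. -/
theorem lintegral_radialPos_le (a r : ℝ) : ∫⁻ s, radialPos r s ∂(uniformRadii a) ≤ 8⁻¹ * 2 := by
  rw [uniformRadii, lintegral_smul_measure, smul_eq_mul]
  gcongr
  have h0 : ∀ᵐ s : ℝ, r ≠ s := by
    filter_upwards [compl_mem_ae_iff.2 (measure_singleton (μ := (volume : Measure ℝ)) r)] with s hs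
    exact fun h => hs h.symm
  calc ∫⁻ s in Set.Icc a (a + 8), radialPos r s ≤ ∫⁻ s, radialPos r s := setLIntegral_le_lintegral _ _
    _ = ∫⁻ s, ENNReal.ofReal (-Real.log (r - s)) := by
        refine lintegral_congr_ae ?_
        filter_upwards [h0] with s hs
        rw [radialPos, if_neg hs, one_div, Real.log_inv, Real.log_abs]
    _ = ∫⁻ t, ENNReal.ofReal (-Real.log t) :=
        lintegral_sub_left_eq_self (fun t => ENNReal.ofReal (-Real.log t)) r
    _ ≤ ∫⁻ t, (Set.Icc (-1 : ℝ) 1).indicator (fun t => ENNReal.ofReal (-Real.log t)) t := by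
        refine lintegral_mono fun t => ?_
        by_cases ht : t ∈ Set.Icc (-1 : ℝ) 1
        · rw [Set.indicator_of_mem ht]
        · rw [Set.indicator_of_notMem ht, nonpos_iff_eq_zero, ENNReal.ofReal_eq_zero,
            Left.neg_nonpos_iff, ← Real.log_abs]
          refine Real.log_nonneg (le_of_not_ge fun h => ht (abs_le.1 h))
    _ = 2 := by rw [lintegral_indicator measurableSet_Icc, lintegral_neg_log_abs]

/-- This is where the length 8 comes from: removing the window `|r - s| < 3` of length 6 leaves
length at least 2, on which `log |r - s| ≥ log 3 > 1`. The result matches the bound for the positive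
part. -/
theorem le_lintegral_radialNeg (a r : ℝ) : 8⁻¹ * 2 ≤ ∫⁻ s, radialNeg r s ∂(uniformRadii a) := by
  rw [uniformRadii, lintegral_smul_measure, smul_eq_mul]
  gcongr
  have hvol : 2 ≤ volume (Set.Icc a (a + 8) \ Set.Ioo (r - 3) (r + 3)) := by
    refine le_trans ?_ (le_measure_sdiff)
    rw [Real.volume_Icc, Real.volume_Ioo, ← ENNReal.ofReal_sub _ (by linarith)]
    rw [show a + 8 - a - (r + 3 - (r - 3)) = 2 by ring]
    simp
  calc (2 : ℝ≥0∞) ≤ ∫⁻ s in Set.Icc a (a + 8) \ Set.Ioo (r - 3) (r + 3), 1 := by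
        rwa [setLIntegral_one]
    _ ≤ ∫⁻ s in Set.Icc a (a + 8) \ Set.Ioo (r - 3) (r + 3), radialNeg r s := by
        refine setLIntegral_mono (measurable_radialNeg r) fun s hs => ?_
        have h3 : 3 ≤ |r - s| := by
          by_contra hlt
          rw [not_le, abs_lt] at hlt
          exact hs.2 ⟨by linarith, by linarith⟩
        rw [radialNeg, ENNReal.one_le_ofReal, Real.le_log_iff_exp_le (by linarith)]
        linarith [Real.exp_one_lt_d9]
    _ ≤ ∫⁻ s in Set.Icc a (a + 8), radialNeg r s := lintegral_mono_set Set.sdiff_subset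

/-- Passing to the distances from `c` contracts distances, so it only increases the kernel `log (1 /
|·|)`. -/
theorem logKernelPos_le_radialPos (c x y : ℂ) :
    logKernelPos x y ≤ radialPos ‖x - c‖ ‖y - c‖ := by
  unfold logKernelPos radialPos
  split_ifs with h1 h2 h2
  · exact le_rfl
  · exact absurd (by rw [h1]) h2
  · exact le_top
  · refine ENNReal.ofReal_le_ofReal ?_
    have h := abs_norm_sub_norm_le (x - c) (y - c)
    rw [sub_sub_sub_cancel_right] at h
    have h0 : 0 < |‖x - c‖ - ‖y - c‖| := abs_pos.2 (sub_ne_zero.2 h2)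
    rw [one_div, one_div, Real.log_inv, Real.log_inv]
    exact neg_le_neg (Real.log_le_log h0 h)

theorem radialNeg_le_logKernelNeg (c x y : ℂ) :
    radialNeg ‖x - c‖ ‖y - c‖ ≤ logKernelNeg x y := by
  unfold logKernelNeg radialNeg
  split_ifs with h1
  · simp [h1]
  · have h := abs_norm_sub_norm_le (x - c) (y - c)
    rw [sub_sub_sub_cancel_right] at h
    rw [one_div, Real.log_inv, neg_neg]
    rcases eq_or_lt_of_le (abs_nonneg (‖x - c‖ - ‖y - c‖)) with h0 | h0
    -- Equal radii are harmless because `Real.log 0 = 0`.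
    · simp [← h0]
    · exact ENNReal.ofReal_le_ofReal (Real.log_le_log h0 h)

/-- The negative part of the kernel is dominated by a sum of one-variable functions. -/
theorem logKernelNeg_le (x y : ℂ) : logKernelNeg x y ≤
    ENNReal.ofReal (Real.log (1 + ‖x‖)) + ENNReal.ofReal (Real.log (1 + ‖y‖)) := by
  unfold logKernelNeg
  split_ifs with h1
  · exact zero_le
  · rw [one_div, Real.log_inv, neg_neg,
      ← ENNReal.ofReal_add (Real.log_nonneg (by simp)) (Real.log_nonneg (by simp)),
      ← Real.log_mul (by positivity) (by positivity)]
    refine ENNReal.ofReal_le_ofReal (Real.log_le_log (norm_pos_iff.2 (sub_ne_zero.2 h1)) ?_)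
    nlinarith [norm_sub_le x y, norm_nonneg x, norm_nonneg y]

theorem lintegral_logKernelNeg_le {F : Set ℂ} {μ : Measure ℂ} (hμ : μ ∈ MOne F) :
    ∫⁻ x, ∫⁻ y, logKernelNeg x y ∂μ ∂μ ≤
      ENNReal.ofReal (2 * ∫ x, Real.log (1 + ‖x‖) ∂μ) := by
  obtain ⟨_, -, hi⟩ := hμ
  have hm : Measurable fun x : ℂ => ENNReal.ofReal (Real.log (1 + ‖x‖)) := by fun_prop
  have hnn : ∀ x : ℂ, 0 ≤ Real.log (1 + ‖x‖) := fun x => Real.log_nonneg (by simp)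
  calc ∫⁻ x, ∫⁻ y, logKernelNeg x y ∂μ ∂μ
      ≤ ∫⁻ x, ∫⁻ y, ENNReal.ofReal (Real.log (1 + ‖x‖)) +
          ENNReal.ofReal (Real.log (1 + ‖y‖)) ∂μ ∂μ :=
        lintegral_mono fun x => lintegral_mono fun y => logKernelNeg_le x y
    _ = 2 * ∫⁻ x, ENNReal.ofReal (Real.log (1 + ‖x‖)) ∂μ := by
        simp_rw [lintegral_add_right _ hm, lintegral_const, measure_univ, mul_one]
        rw [lintegral_add_right _ measurable_const, lintegral_const, measure_univ, mul_one, two_mul]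
    _ = _ := by
        rw [← ofReal_integral_eq_lintegral_ofReal hi (Filter.Eventually.of_forall hnn),
          ENNReal.ofReal_mul zero_le_two, ENNReal.ofReal_ofNat]

/-- Upper bound for the weighted energy of a closed set that meets all circles with radii in an
interval of length `8`. -/
theorem setEnergy_le_of_circles (V : ℂ[X]) {F : Set ℂ} (hF : IsClosed F) (c : ℂ) {a B : ℝ}
    (hS : ∀ r ∈ Set.Icc a (a + 8), ∃ z ∈ F, ‖z - c‖ = r)
    (hB : ∀ z ∈ Metric.closedBall c (a + 8), field V z ≤ B) : setEnergy V F ≤ (B : EReal) := by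
  have hK : IsCompact (F ∩ Metric.closedBall c (a + 8)) :=
    (isCompact_closedBall c (a + 8)).inter_left hF
  have hf : Continuous fun z : ℂ => ‖z - c‖ := by fun_prop
  obtain ⟨μ, hμ, hμK, hμν⟩ := exists_lift_measure hK _ hf (uniformRadii a)
    (fun r hr => by
      obtain ⟨z, hz, hzr⟩ := hS r hr
      exact ⟨z, ⟨hz, by rw [Metric.mem_closedBall, dist_eq_norm, hzr]; exact hr.2⟩, hzr⟩)
    (ae_uniformRadii a)
  have hae : ∀ᵐ z ∂μ, z ∈ F ∩ Metric.closedBall c (a + 8) := hμK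
  have hint : ∀ g : ℂ → ℝ, Continuous g → Integrable g μ := by
    intro g hg
    obtain ⟨C, hC⟩ := hK.exists_bound_of_continuousOn hg.continuousOn
    refine Integrable.of_bound hg.aestronglyMeasurable C ?_
    filter_upwards [hae] with z hz using hC z hz
  have hcφ : Continuous (field V) := Complex.continuous_re.comp V.continuous
  have hMOne : μ ∈ MOne F := by
    refine ⟨hμ, measure_mono_null (Set.compl_subset_compl.2 Set.inter_subset_left) hμK, hint _ ?_⟩
    exact (continuous_const.add continuous_norm).log fun x =>
      (add_pos_of_pos_of_nonneg one_pos (norm_nonneg x)).ne'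
  have hin : ∀ x : ℂ, ∫⁻ y, logKernelPos x y ∂μ ≤ 8⁻¹ * 2 ∧ 8⁻¹ * 2 ≤ ∫⁻ y, logKernelNeg x y ∂μ := by
    intro x
    constructor
    · refine (lintegral_mono fun y => logKernelPos_le_radialPos c x y).trans ?_
      rw [← lintegral_map (measurable_radialPos _) hf.measurable, hμν]
      exact lintegral_radialPos_le _ _
    · refine le_trans ?_ (lintegral_mono fun y => radialNeg_le_logKernelNeg c x y)
      rw [← lintegral_map (measurable_radialNeg _) hf.measurable, hμν]
      exact le_lintegral_radialNeg _ _
  -- The inner integrals are separated by the same constant `8⁻¹ * 2` for every `x`, so the energy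
  -- is nonpositive.
  have hle : ∫⁻ x, ∫⁻ y, logKernelPos x y ∂μ ∂μ ≤ ∫⁻ x, ∫⁻ y, logKernelNeg x y ∂μ ∂μ :=
    lintegral_mono fun x => (hin x).1.trans (hin x).2
  have hN : ∫⁻ x, ∫⁻ y, logKernelNeg x y ∂μ ∂μ ≠ ⊤ :=
    ne_top_of_le_ne_top ENNReal.ofReal_ne_top (lintegral_logKernelNeg_le hMOne)
  have hP := ne_top_of_le_ne_top hN hle
  have hE : logEnergy μ = (((∫⁻ x, ∫⁻ y, logKernelPos x y ∂μ ∂μ).toReal -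
      (∫⁻ x, ∫⁻ y, logKernelNeg x y ∂μ ∂μ).toReal : ℝ) : EReal) := by
    rw [logEnergy, EReal.coe_sub,
      EReal.coe_ennreal_toReal hP, EReal.coe_ennreal_toReal hN]
  have hmem : μ ∈ MOneField V F := by
    refine ⟨hMOne, ?_, ?_, hint _ hcφ⟩ <;> rw [hE]
    exacts [EReal.coe_ne_top _, EReal.coe_ne_bot _]
  refine (iInf₂_le μ hmem).trans ?_
  rw [weightedEnergy, hE, ← EReal.coe_add, EReal.coe_le_coe_iff]
  have h1 := ENNReal.toReal_mono hN hle
  have h2 : ∫ x, field V x ∂μ ≤ B := by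
    calc ∫ x, field V x ∂μ ≤ ∫ _x, B ∂μ := by
          refine integral_mono_ae (hint _ hcφ) (integrable_const B) ?_
          filter_upwards [hae] with z hz using hB z hz.2
      _ = B := by simp
  linarith

/-- Lower bound for the weighted energy of a set on which the field dominates the logarithm. -/
theorem le_setEnergy (V : ℂ[X]) {F : Set ℂ} {C : ℝ}
    (hC : ∀ z ∈ F, 2 * Real.log (1 + ‖z‖) - C ≤ field V z) : ((-C : ℝ) : EReal) ≤ setEnergy V F := by
  refine le_iInf₂ fun μ hμ => ?_
  obtain ⟨hM, -, -, hφ⟩ := hμ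
  obtain ⟨hprob, hsupp, hi⟩ := id hM
  have hL : 0 ≤ ∫ x, Real.log (1 + ‖x‖) ∂μ :=
    integral_nonneg fun x => Real.log_nonneg (by simp)
  have hfield : 2 * ∫ x, Real.log (1 + ‖x‖) ∂μ - C ≤ ∫ x, field V x ∂μ := by
    have : ∫ x, (2 * Real.log (1 + ‖x‖) - C) ∂μ ≤ ∫ x, field V x ∂μ := by
      refine integral_mono_ae ((hi.const_mul 2).sub (integrable_const C)) hφ ?_
      have hae : ∀ᵐ z ∂μ, z ∈ F := hsupp
      filter_upwards [hae] with z hz using hC z hz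
    rw [integral_sub (hi.const_mul 2) (integrable_const C), integral_const_mul] at this
    simpa using this
  have hlog : ((-(2 * ∫ x, Real.log (1 + ‖x‖) ∂μ) : ℝ) : EReal) ≤ logEnergy μ := by
    -- The positive part of the energy is discarded.
    rw [logEnergy, EReal.coe_neg, ← zero_sub]
    refine EReal.sub_le_sub (EReal.coe_ennreal_nonneg _) ?_
    refine (EReal.coe_ennreal_le_coe_ennreal_iff.2 (lintegral_logKernelNeg_le hM)).trans ?_
    rw [EReal.coe_ennreal_ofReal, max_eq_left (by positivity)]
  calc ((-C : ℝ) : EReal)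
      ≤ ((-(2 * ∫ x, Real.log (1 + ‖x‖) ∂μ) + ∫ x, field V x ∂μ : ℝ) : EReal) :=
        EReal.coe_le_coe_iff.2 (by linarith)
    _ ≤ weightedEnergy V μ := by
        rw [EReal.coe_add, weightedEnergy]
        gcongr

/-! ### The polynomial near infinity -/

section Asymptotics

variable {V : ℂ[X]}

/-- Comparing `V` at `w` with the leading term at `z` controls `φ` on the whole disc of radius 8
about `z` at once. The error has order `N - 1`: the lower coefficients, plus the cost of moving `w ^
N` to `z ^ N`. -/
theorem exists_norm_eval_sub_le (V : ℂ[X]) : ∃ K : ℝ, 0 ≤ K ∧ ∀ z w : ℂ, 9 ≤ ‖z‖ → ‖w - z‖ ≤ 8 →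
    ‖V.eval w - V.leadingCoeff * z ^ V.natDegree‖ ≤ K * ‖z‖ ^ (V.natDegree - 1) := by
  set N := V.natDegree with hN
  set a := V.leadingCoeff with ha
  refine ⟨(∑ i ∈ Finset.range N, ‖V.coeff i‖ + ‖a‖ * (8 * N)) * 2 ^ (N - 1), by positivity, ?_⟩
  intro z w hz hw
  have hw2 : ‖w‖ ≤ 2 * ‖z‖ := by linarith [norm_le_norm_add_norm_sub' w z]
  have hz2 : ‖z‖ ≤ 2 * ‖z‖ := by linarith
  have h1 : V.eval w - a * z ^ N =
      ∑ i ∈ Finset.range N, V.coeff i * w ^ i + a * (w ^ N - z ^ N) := by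
    rw [Polynomial.eval_eq_sum_range, Finset.sum_range_succ]
    simp only [← hN, ha, Polynomial.leadingCoeff]
    ring
  have h2 : ‖∑ i ∈ Finset.range N, V.coeff i * w ^ i‖ ≤
      (∑ i ∈ Finset.range N, ‖V.coeff i‖) * (2 * ‖z‖) ^ (N - 1) := by
    rw [Finset.sum_mul]
    refine (norm_sum_le _ _).trans (Finset.sum_le_sum fun i hi => ?_)
    rw [norm_mul, norm_pow]
    have hi' := Finset.mem_range.1 hi
    gcongr
    calc ‖w‖ ^ i ≤ (2 * ‖z‖) ^ i := by gcongr
      _ ≤ (2 * ‖z‖) ^ (N - 1) := pow_le_pow_right₀ (by linarith) (by omega)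
  have h3 : ‖w ^ N - z ^ N‖ ≤ 8 * N * (2 * ‖z‖) ^ (N - 1) := by
    rw [← (Commute.all w z).mul_geom_sum₂, norm_mul]
    have : ‖∑ i ∈ Finset.range N, w ^ i * z ^ (N - 1 - i)‖ ≤
        ∑ _i ∈ Finset.range N, (2 * ‖z‖) ^ (N - 1) := by
      refine (norm_sum_le _ _).trans (Finset.sum_le_sum fun i hi => ?_)
      have hi' := Finset.mem_range.1 hi
      rw [norm_mul, norm_pow, norm_pow]
      calc ‖w‖ ^ i * ‖z‖ ^ (N - 1 - i) ≤ (2 * ‖z‖) ^ i * (2 * ‖z‖) ^ (N - 1 - i) := by gcongr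
        _ = (2 * ‖z‖) ^ (N - 1) := by rw [← pow_add]; congr 1; omega
    rw [Finset.sum_const, Finset.card_range, nsmul_eq_mul] at this
    rw [mul_assoc]
    gcongr
  rw [h1]
  refine (norm_add_le _ _).trans ?_
  rw [norm_mul]
  calc _ ≤ (∑ i ∈ Finset.range N, ‖V.coeff i‖) * (2 * ‖z‖) ^ (N - 1) +
        ‖a‖ * (8 * N * (2 * ‖z‖) ^ (N - 1)) := by gcongr
    _ = _ := by rw [mul_pow]; ring

theorem continuous_field (V : ℂ[X]) : Continuous (field V) :=
  Complex.continuous_re.comp V.continuous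

theorem leadingCoeff_ne_zero_of_degree (hV : 2 ≤ V.natDegree) : V.leadingCoeff ≠ 0 := by
  intro h
  rw [Polynomial.leadingCoeff_eq_zero] at h
  simp [h] at hV

/-- Far from the origin, the points where the leading term is real and nonpositive belong to the
forbidden region. -/
theorem exists_forall_mem_forbidden (hV : 2 ≤ V.natDegree) (M : ℝ) :
    ∃ R : ℝ, 0 ≤ R ∧ ∀ z : ℂ, R ≤ ‖z‖ →
      V.leadingCoeff * z ^ V.natDegree ∉ Complex.slitPlane → z ∈ forbidden V M := by
  obtain ⟨K, hK, hKV⟩ := exists_norm_eval_sub_le V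
  have ha : 0 < ‖V.leadingCoeff‖ := norm_pos_iff.2 (leadingCoeff_ne_zero_of_degree hV)
  refine ⟨max 9 ((K + |M| + 1) / ‖V.leadingCoeff‖), by positivity, fun z hz hs => ?_⟩
  have h9 : 9 ≤ ‖z‖ := (le_max_left _ _).trans hz
  have hz' : K + |M| + 1 ≤ ‖z‖ * ‖V.leadingCoeff‖ :=
    (div_le_iff₀ ha).1 ((le_max_right _ _).trans hz)
  rw [Complex.mem_slitPlane_iff, not_or, not_lt, not_not] at hs
  have hre : (V.leadingCoeff * z ^ V.natDegree).re = -(‖V.leadingCoeff‖ * ‖z‖ ^ V.natDegree) := by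
    have h1 : ‖V.leadingCoeff * z ^ V.natDegree‖ = |(V.leadingCoeff * z ^ V.natDegree).re| := by
      rw [Complex.abs_re_eq_norm.2 hs.2]
    rw [abs_of_nonpos hs.1, norm_mul, norm_pow] at h1
    linarith
  -- A whole closed disc of radius 8 below `-M` is what places its centre in `Δ_M`.
  have hball : ∀ w : ℂ, ‖w - z‖ ≤ 8 → field V w < -M := by
    intro w hw
    have h1 := (Complex.abs_re_le_norm _).trans (hKV z w h9 hw)
    rw [Complex.sub_re, hre] at h1
    have h2 := (abs_le.1 h1).2
    have h3 : ‖z‖ ^ V.natDegree = ‖z‖ ^ (V.natDegree - 1) * ‖z‖ := by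
      rw [← pow_succ]; congr 1; omega
    have h4 : 1 ≤ ‖z‖ ^ (V.natDegree - 1) := one_le_pow₀ (by linarith)
    rw [h3] at h2
    have h5 : |M| + 1 ≤ ‖z‖ ^ (V.natDegree - 1) * (‖z‖ * ‖V.leadingCoeff‖ - K) := by
      nlinarith [abs_nonneg M]
    have h6 := le_abs_self M
    unfold field
    nlinarith
  refine ⟨hball z (by simp), ?_⟩
  have hcl : IsClosed {w | field V w = -M} := isClosed_eq (continuous_field V) continuous_const
  -- `Metric.infDist` to the empty set is `0`, so the level set must be shown nonempty; a root of `V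
  -- + M` lies on it.
  have hne : {w | field V w = -M}.Nonempty := by
    obtain ⟨w, hw⟩ := IsAlgClosed.exists_root (V - Polynomial.C ((-M : ℝ) : ℂ)) (by
      intro h
      have := Polynomial.natDegree_sub_C (p := V) (a := ((-M : ℝ) : ℂ))
      rw [Polynomial.natDegree_eq_zero_iff_degree_le_zero.2 h.le] at this
      omega)
    refine ⟨w, ?_⟩
    rw [Polynomial.IsRoot, Polynomial.eval_sub, Polynomial.eval_C, sub_eq_zero] at hw
    show (V.eval w).re = -M
    rw [hw, Complex.ofReal_re]
  obtain ⟨w, hw, hd⟩ := hcl.exists_infDist_eq_dist hne z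
  rw [hd, dist_comm, dist_eq_norm]
  by_contra hle
  exact (hball w (not_lt.1 hle)).ne hw

/-- Where the leading term is real and nonnegative, the field dominates the logarithm. -/
theorem exists_forall_log_le_field (hV : 2 ≤ V.natDegree) :
    ∃ C : ℝ, ∀ z : ℂ, (V.leadingCoeff * z ^ V.natDegree).re = ‖V.leadingCoeff‖ * ‖z‖ ^ V.natDegree →
      2 * Real.log (1 + ‖z‖) - C ≤ field V z := by
  obtain ⟨K, hK, hKV⟩ := exists_norm_eval_sub_le V
  have ha : 0 < ‖V.leadingCoeff‖ := norm_pos_iff.2 (leadingCoeff_ne_zero_of_degree hV)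
  set R := max 9 ((K + 2) / ‖V.leadingCoeff‖) with hR
  have hR0 : 0 ≤ R := by positivity
  obtain ⟨B, hB⟩ := (isCompact_closedBall (0 : ℂ) R).exists_bound_of_continuousOn
    (continuous_field V).continuousOn
  have hB0 : 0 ≤ B := (norm_nonneg _).trans (hB 0 (by simpa using hR0))
  refine ⟨B + 2 * R, fun z hz => ?_⟩
  have hlog : Real.log (1 + ‖z‖) ≤ ‖z‖ := by
    have := Real.log_le_sub_one_of_pos (x := 1 + ‖z‖) (by positivity)
    linarith
  rcases le_total ‖z‖ R with h | h
  · have := hB z (by simpa using h)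
    rw [Real.norm_eq_abs] at this
    linarith [(abs_le.1 this).1]
  · have h9 : 9 ≤ ‖z‖ := (le_max_left _ _).trans h
    have hz' : K + 2 ≤ ‖z‖ * ‖V.leadingCoeff‖ := (div_le_iff₀ ha).1 ((le_max_right _ _).trans h)
    have h1 := (Complex.abs_re_le_norm _).trans (hKV z z h9 (by simp))
    rw [Complex.sub_re, hz] at h1
    have h2 := (abs_le.1 h1).1
    have h3 : ‖z‖ ^ V.natDegree = ‖z‖ ^ (V.natDegree - 1) * ‖z‖ := by
      rw [← pow_succ]; congr 1; omega
    -- Here `N ≥ 2` enters: the field then grows at least like `2 ‖z‖`, which beats `2 log (1 +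
    -- ‖z‖)`.
    have h4 : ‖z‖ ≤ ‖z‖ ^ (V.natDegree - 1) := le_self_pow₀ (by linarith) (by omega)
    rw [h3] at h2
    have h5 : 2 * ‖z‖ ≤ ‖z‖ ^ (V.natDegree - 1) * (‖z‖ * ‖V.leadingCoeff‖ - K) := by nlinarith
    unfold field
    nlinarith

end Asymptotics

/-! ### Separation of the sectors -/

section Sectors

variable {V : ℂ[X]}

/-- The direction of the centre of the `j`-th sector. -/
def direction (V : ℂ[X]) (j : Fin V.natDegree) : ℂ := Complex.exp ((sectorAngle V j : ℂ) * Complex.I)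

theorem norm_direction (j : Fin V.natDegree) : ‖direction V j‖ = 1 :=
  Complex.norm_exp_ofReal_mul_I _

theorem direction_ne_zero (j : Fin V.natDegree) : direction V j ≠ 0 := Complex.exp_ne_zero _

theorem exp_neg_sectorAngle (j : Fin V.natDegree) :
    Complex.exp (-(sectorAngle V j : ℂ) * Complex.I) = (direction V j)⁻¹ := by
  rw [direction, ← Complex.exp_neg, neg_mul]

theorem leadingCoeff_mul_direction_pow (j : Fin V.natDegree) :
    V.leadingCoeff * direction V j ^ V.natDegree = ‖V.leadingCoeff‖ := by
  have hN : (V.natDegree : ℂ) ≠ 0 := Nat.cast_ne_zero.2 (Fin.pos j).ne'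
  conv_lhs => rw [← Complex.norm_mul_exp_arg_mul_I V.leadingCoeff]
  rw [direction, ← Complex.exp_nat_mul, mul_assoc, ← Complex.exp_add]
  have : (V.leadingCoeff.arg : ℂ) * Complex.I +
      V.natDegree * ((sectorAngle V j : ℂ) * Complex.I) = ((j : ℕ) : ℂ) * (2 * Real.pi * Complex.I) := by
    rw [sectorAngle]
    push_cast
    field_simp
    ring
  rw [this, Complex.exp_nat_mul, Complex.exp_two_pi_mul_I, one_pow, mul_one]

theorem direction_injective : Function.Injective (direction V) := by
  intro j k h
  have hN : (0 : ℝ) < V.natDegree := Nat.cast_pos.2 (Fin.pos j)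
  obtain ⟨n, hn⟩ := Complex.exp_eq_exp_iff_exists_int.1 h
  have h1 : (sectorAngle V j : ℂ) = sectorAngle V k + n * (2 * Real.pi) := by
    apply mul_right_cancel₀ Complex.I_ne_zero
    rw [hn]; ring
  have h2 : sectorAngle V j = sectorAngle V k + n * (2 * Real.pi) := by exact_mod_cast h1
  rw [sectorAngle, sectorAngle] at h2
  have h3 : ((j : ℕ) : ℝ) = (k : ℕ) + n * V.natDegree := by
    have hπ := Real.pi_pos
    field_simp at h2
    have : 2 * Real.pi * (((j : ℕ) : ℝ) - ((k : ℕ) + n * V.natDegree)) = 0 := by linarith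
    rcases mul_eq_zero.1 this with h | h
    · linarith
    · linarith
  have h4 : ((j : ℕ) : ℤ) = (k : ℕ) + n * V.natDegree := by exact_mod_cast h3
  have hj := j.2
  have hk := k.2
  have hn0 : n = 0 := by
    have h5 : n < 1 := by
      by_contra hc
      have : 1 * (V.natDegree : ℤ) ≤ n * V.natDegree := by gcongr; omega
      omega
    have h6 : -1 < n := by
      by_contra hc
      have : n * (V.natDegree : ℤ) ≤ (-1) * V.natDegree := by gcongr; omega
      omega
    omega
  rw [hn0] at h4
  exact Fin.ext (by omega)

/-- A branch of `z ↦ z / (a₀ z ^ N) ^ (1 / N)`; it is locally constant where `a₀ z ^ N` is not a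
nonpositive real number. -/
def rootBranch (V : ℂ[X]) (z : ℂ) : ℂ :=
  z / (V.leadingCoeff * z ^ V.natDegree) ^ ((V.natDegree : ℂ)⁻¹)

theorem rootBranch_of_mem_sector {j : Fin V.natDegree} {z : ℂ} (hz : z ∈ sector V j) :
    rootBranch V z = direction V j / ((‖V.leadingCoeff‖ ^ ((V.natDegree : ℝ)⁻¹) : ℝ) : ℂ) := by
  obtain ⟨hz0, harg⟩ := hz
  have hN : 0 < V.natDegree := Fin.pos j
  have ha : 0 < ‖V.leadingCoeff‖ := by
    rw [norm_pos_iff, Ne, Polynomial.leadingCoeff_eq_zero]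
    rintro rfl
    simp at hN
  rw [exp_neg_sectorAngle] at harg
  set u := z * (direction V j)⁻¹ with hu
  set ρ := ‖V.leadingCoeff‖ ^ ((V.natDegree : ℝ)⁻¹) with hρ
  have hρ0 : 0 < ρ := Real.rpow_pos_of_pos ha _
  have hzu : z = u * direction V j := by
    rw [hu, inv_mul_cancel_right₀ (direction_ne_zero j)]
  have hu0 : u ≠ 0 := mul_ne_zero hz0 (inv_ne_zero (direction_ne_zero j))
  clear_value u
  -- The principal `N`-th root of `(ρ u) ^ N` is `ρ u` itself, because `|arg u| < π / (2N)`.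
  have hpow : V.leadingCoeff * z ^ V.natDegree = ((ρ : ℂ) * u) ^ V.natDegree := by
    rw [hzu, mul_pow, mul_pow, mul_left_comm, leadingCoeff_mul_direction_pow, mul_comm,
      ← Complex.ofReal_pow, hρ, Real.rpow_inv_natCast_pow (norm_nonneg _) hN.ne']
  have hlt : Real.pi / (2 * V.natDegree) ≤ Real.pi / V.natDegree := by
    have : (0 : ℝ) < V.natDegree := Nat.cast_pos.2 hN
    gcongr
    linarith
  have harg' := abs_lt.1 harg
  rw [rootBranch, hpow, Complex.pow_cpow_nat_inv hN.ne'
    (by rw [Complex.arg_real_mul _ hρ0]; linarith) (by rw [Complex.arg_real_mul _ hρ0]; linarith),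
    hzu]
  have : (ρ : ℂ) ≠ 0 := Complex.ofReal_ne_zero.2 hρ0.ne'
  field_simp

theorem eq_of_rootBranch_eq {j k : Fin V.natDegree} {z w : ℂ} (hz : z ∈ sector V j)
    (hw : w ∈ sector V k) (h : rootBranch V z = rootBranch V w) : j = k := by
  rw [rootBranch_of_mem_sector hz, rootBranch_of_mem_sector hw] at h
  refine direction_injective ((div_left_inj' ?_).1 h)
  have hN : 0 < V.natDegree := Fin.pos j
  refine Complex.ofReal_ne_zero.2 (Real.rpow_pos_of_pos ?_ _).ne'
  rw [norm_pos_iff, Ne, Polynomial.leadingCoeff_eq_zero]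
  rintro rfl
  simp at hN

/-- A connected set on which `a₀ z ^ N` avoids the nonpositive reals meets at most one sector. -/
theorem sector_unique_of_isPreconnected {C : Set ℂ} (hC : IsPreconnected C)
    (hs : ∀ z ∈ C, V.leadingCoeff * z ^ V.natDegree ∈ Complex.slitPlane)
    {j k : Fin V.natDegree} {z w : ℂ} (hzC : z ∈ C) (hwC : w ∈ C) (hz : z ∈ sector V j)
    (hw : w ∈ sector V k) : j = k := by
  have hN : 0 < V.natDegree := Fin.pos j
  have hcont : ContinuousOn (rootBranch V) C := by
    intro x hx
    have h1 : ContinuousAt (fun z => (V.leadingCoeff * z ^ V.natDegree) ^ ((V.natDegree : ℂ)⁻¹)) x :=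
      ContinuousAt.comp (g := fun y : ℂ => y ^ ((V.natDegree : ℂ)⁻¹))
        (continuousAt_cpow_const (hs x hx)) (by fun_prop)
    refine (continuousAt_id.div h1 ?_).continuousWithinAt
    rw [Ne, Complex.cpow_eq_zero_iff, not_and_or]
    exact Or.inl (Complex.slitPlane_ne_zero (hs x hx))
  -- The `N`-th power of the branch is the constant `1 / a₀`, so a continuous branch on a connected
  -- set takes a single value.
  have hfin : (rootBranch V '' C).Finite := by
    refine (Multiset.toFinset (Polynomial.nthRoots V.natDegree V.leadingCoeff⁻¹)).finite_toSet.subset ?_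
    rintro _ ⟨x, hx, rfl⟩
    rw [Finset.mem_coe, Multiset.mem_toFinset, Polynomial.mem_nthRoots hN, rootBranch, div_pow,
      Complex.cpow_nat_inv_pow _ hN.ne']
    have h0 := Complex.slitPlane_ne_zero (hs x hx)
    rw [← div_div, div_right_comm, div_self (right_ne_zero_of_mul h0), one_div]
  exact eq_of_rootBranch_eq hz hw (hfin.countable.isTotallyDisconnected _ subset_rfl
    (hC.image _ hcont) ⟨z, hzC, rfl⟩ ⟨w, hwC, rfl⟩)

theorem StretchesOut.exists_mem_sector {F : Set ℂ} {j : Fin V.natDegree} (h : StretchesOut V F j) :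
    ∃ z ∈ F, z ∈ sector V j := by
  obtain ⟨ε, hε, r₀, -, h⟩ := h
  obtain ⟨z, hz, -, hz0, harg⟩ := h (r₀ + 1) (by linarith)
  exact ⟨z, hz, hz0, harg.trans (by linarith)⟩

end Sectors

/-! ### Closedness of arcs and radii attained by unbounded connected sets -/

/-- Tending to infinity along the infinite ends makes the parametrization a proper map on `I`, hence
a closed one. -/
theorem IsC1JordanArc.isClosed {C : Set ℂ} (h : IsC1JordanArc C) : IsClosed C := by
  obtain ⟨I, γ, hI, -, -, hγ, -, -, hlim, rfl⟩ := h
  have hp : IsProperMap (I.domRestrict γ) := by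
    rw [isProperMap_iff_tendsto_cocompact]
    refine ⟨hγ.continuousOn.domRestrict, hlim.comp ?_⟩
    refine Filter.tendsto_inf.2 ⟨hI.isClosedEmbedding_subtypeVal.tendsto_cocompact, ?_⟩
    exact Filter.tendsto_principal.2 (Filter.Eventually.of_forall fun x => x.2)
  rw [← Set.range_domRestrict]
  exact hp.isClosedMap.isClosed_range

theorem IsAdmissible.isClosed {V : ℂ[X]} {P : Finpartition (Finset.univ : Finset (Fin V.natDegree))}
    {Γ : Set ℂ} (h : IsAdmissible V P Γ) : IsClosed Γ := by
  obtain ⟨𝒞, hfin, harc, rfl⟩ := h.finite_union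
  rw [Set.sUnion_eq_biUnion]
  exact hfin.isClosed_biUnion fun C hC => (harc C hC).isClosed

theorem IsPreconnected.exists_norm_sub_eq {C : Set ℂ} (hC : IsPreconnected C)
    (hub : ¬ Bornology.IsBounded C) {x : ℂ} (hx : x ∈ C) (c : ℂ) {r : ℝ} (hr : ‖x - c‖ ≤ r) :
    ∃ z ∈ C, ‖z - c‖ = r := by
  obtain ⟨y, hy, hyr⟩ : ∃ y ∈ C, r ≤ ‖y - c‖ := by
    by_contra! hcon
    refine hub (Metric.isBounded_closedBall.subset (fun y hy => ?_ : C ⊆ Metric.closedBall c r))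
    rw [Metric.mem_closedBall, dist_eq_norm]
    exact (hcon y hy).le
  have hf : ContinuousOn (fun z : ℂ => ‖z - c‖) C := by fun_prop
  exact hC.intermediate_value hx hy hf ⟨hr, hyr⟩

/-! ### Hausdorff limits on the sphere -/

/-- The stereographic projection, inverse to `stereo` off the pole. -/
def stereoInv (q : EuclideanSpace ℝ (Fin 3)) : ℂ := ⟨q 0 / (1 - q 2), q 1 / (1 - q 2)⟩

theorem stereo_coe (z : ℂ) : stereo (z : OnePoint ℂ) =
    !₂[z.re / (1 + ‖z‖ ^ 2), z.im / (1 + ‖z‖ ^ 2), ‖z‖ ^ 2 / (1 + ‖z‖ ^ 2)] := rfl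

theorem stereo_coe_two_lt_one (z : ℂ) : stereo (z : OnePoint ℂ) 2 < 1 := by
  rw [stereo_coe]
  show ‖z‖ ^ 2 / (1 + ‖z‖ ^ 2) < 1
  rw [div_lt_one (by positivity)]
  linarith

theorem stereo_infty_two : stereo OnePoint.infty 2 = 1 := rfl

theorem stereoInv_stereo (z : ℂ) : stereoInv (stereo (z : OnePoint ℂ)) = z := by
  have h : (1 + ‖z‖ ^ 2) ≠ 0 := by positivity
  have h1 : 1 - ‖z‖ ^ 2 / (1 + ‖z‖ ^ 2) = 1 / (1 + ‖z‖ ^ 2) := by field_simp; ring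
  rw [stereo_coe]
  apply Complex.ext
  · show z.re / (1 + ‖z‖ ^ 2) / (1 - ‖z‖ ^ 2 / (1 + ‖z‖ ^ 2)) = z.re
    rw [h1]; field_simp
  · show z.im / (1 + ‖z‖ ^ 2) / (1 - ‖z‖ ^ 2 / (1 + ‖z‖ ^ 2)) = z.im
    rw [h1]; field_simp

theorem continuous_stereo_coe : Continuous fun z : ℂ => stereo (z : OnePoint ℂ) := by
  refine (PiLp.continuous_toLp 2 _).comp (continuous_pi fun i => ?_)
  have h : ∀ z : ℂ, 1 + ‖z‖ ^ 2 ≠ 0 := fun z => by positivity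
  fin_cases i
  · exact Complex.continuous_re.div (by fun_prop) h
  · exact Complex.continuous_im.div (by fun_prop) h
  · exact Continuous.div (by fun_prop) (by fun_prop) h

theorem continuousAt_stereoInv {q : EuclideanSpace ℝ (Fin 3)} (hq : q 2 ≠ 1) :
    ContinuousAt stereoInv q := by
  have h : 1 - q 2 ≠ 0 := sub_ne_zero.2 hq.symm
  have hc : ∀ i, ContinuousAt (fun p : EuclideanSpace ℝ (Fin 3) => p i) q := fun i => by fun_prop
  have : stereoInv = fun p : EuclideanSpace ℝ (Fin 3) =>
      ((p 0 / (1 - p 2) : ℝ) : ℂ) + ((p 1 / (1 - p 2) : ℝ) : ℂ) * Complex.I := by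
    ext p
    rw [stereoInv, Complex.mk_eq_add_mul_I]
  rw [this]
  have hr : ∀ i, ContinuousAt (fun p : EuclideanSpace ℝ (Fin 3) => ((p i / (1 - p 2) : ℝ) : ℂ)) q :=
    fun i => Complex.continuous_ofReal.continuousAt.comp
      ((hc i).div (continuousAt_const.sub (hc 2)) h)
  exact (hr 0).add ((hr 1).mul continuousAt_const)

/-- A compact set that meets sets arbitrarily close to the closed set `F` meets `F`. -/
theorem exists_mem_of_sphereHausdorff {F K : Set ℂ} (hF : IsClosed F) (hK : IsCompact K)
    (h : ∀ ε > (0 : ℝ≥0∞), ∃ Γ : Set ℂ, (Γ ∩ K).Nonempty ∧ sphereHausdorff F Γ < ε) :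
    ∃ z ∈ F, z ∈ K := by
  have hstep : ∀ n : ℕ, ∃ p ∈ K, ∃ q ∈ addInfty F,
      edist (stereo (p : OnePoint ℂ)) (stereo q) < ENNReal.ofReal (1 / ((n : ℝ) + 1)) := by
    intro n
    obtain ⟨Γ, ⟨p, hpΓ, hpK⟩, hΓ⟩ := h _ (ENNReal.ofReal_pos.2 (Nat.one_div_pos_of_nat (n := n)))
    rw [sphereHausdorff, Metric.hausdorffEDist_comm] at hΓ
    obtain ⟨_, ⟨q, hq, rfl⟩, hpq⟩ := Metric.exists_edist_lt_of_hausdorffEDist_lt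
      (Set.mem_image_of_mem stereo (Or.inl ⟨p, hpΓ, rfl⟩)) hΓ
    exact ⟨p, hpK, q, hq, hpq⟩
  choose p hpK q hqF hpq using hstep
  obtain ⟨z, hzK, φ, hφ, hlim⟩ := hK.tendsto_subseq hpK
  have h1 : Filter.Tendsto (fun n => stereo (p (φ n) : OnePoint ℂ)) Filter.atTop
      (nhds (stereo (z : OnePoint ℂ))) := (continuous_stereo_coe.tendsto z).comp hlim
  have h2 : Filter.Tendsto (fun n => stereo (q (φ n))) Filter.atTop
      (nhds (stereo (z : OnePoint ℂ))) := by
    refine h1.congr_dist ?_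
    refine squeeze_zero (fun _ => dist_nonneg) (fun n => ?_)
      (tendsto_one_div_add_atTop_nhds_zero_nat.comp hφ.tendsto_atTop)
    have := hpq (φ n)
    rw [edist_dist, ENNReal.ofReal_lt_ofReal_iff (Nat.one_div_pos_of_nat)] at this
    exact this.le
  have hz1 := stereo_coe_two_lt_one z
  have h3 := (continuousAt_stereoInv hz1.ne).tendsto.comp h2
  rw [stereoInv_stereo] at h3
  -- The limit lies strictly below the pole, so the approximating points are eventually not the
  -- point at infinity and come from `F`.
  have h4 : ∀ᶠ n in Filter.atTop, stereo (q (φ n)) 2 < 1 := by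
    have hc : Continuous fun x : EuclideanSpace ℝ (Fin 3) => x 2 := by fun_prop
    exact ((hc.tendsto _).comp h2).eventually_lt_const hz1
  refine ⟨z, hF.mem_of_tendsto h3 ?_, hzK⟩
  filter_upwards [h4] with n hn
  rcases hqF (φ n) with ⟨w, hw, hwq⟩ | ⟨hinf, -⟩
  · simp only [Function.comp, ← hwq]
    rwa [stereoInv_stereo]
  · rw [hinf, stereo_infty_two] at hn
    exact absurd hn (lt_irrefl _)

/-! ### The star of central rays -/

section Star

variable {V : ℂ[X]}

/-- The closed ray from the origin through the middle of the `j`-th sector. -/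
def ray (V : ℂ[X]) (j : Fin V.natDegree) : Set ℂ :=
  (fun t : ℝ => (t : ℂ) * direction V j) '' Set.Ici 0

/-- The union of the central rays with indices in `J`. -/
def star (V : ℂ[X]) (J : Set (Fin V.natDegree)) : Set ℂ := ⋃ j ∈ J, ray V j

theorem zero_mem_ray (j : Fin V.natDegree) : (0 : ℂ) ∈ ray V j := ⟨0, by simp, by simp⟩

theorem isC1JordanArc_ray (j : Fin V.natDegree) : IsC1JordanArc (ray V j) := by
  have hd : ∀ t : ℝ, HasDerivAt (fun t : ℝ => (t : ℂ) * direction V j) (direction V j) t := by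
    intro t
    simpa using (Complex.ofRealCLM.hasDerivAt (x := t)).mul_const (direction V j)
  refine ⟨Set.Ici 0, fun t => (t : ℂ) * direction V j, isClosed_Ici, Set.ordConnected_Ici,
    ⟨0, by simp, 1, by simp, zero_ne_one⟩, ?_, fun t ht => ?_, ?_, ?_, rfl⟩
  · exact (Complex.ofRealCLM.contDiff.mul contDiff_const).contDiffOn
  · rw [(hd t).hasDerivWithinAt.derivWithin (uniqueDiffOn_Ici 0 t ht)]
    exact direction_ne_zero j
  · intro s _ t _ h
    exact_mod_cast mul_right_cancel₀ (direction_ne_zero j) h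
  · refine Filter.Tendsto.mono_left ?_ inf_le_left
    rw [← Metric.cobounded_eq_cocompact, ← Metric.cobounded_eq_cocompact,
      ← tendsto_norm_atTop_iff_cobounded]
    simp only [norm_mul, norm_direction, mul_one, Complex.norm_real]
    exact tendsto_norm_cobounded_atTop

theorem mem_sector_of_pos {j : Fin V.natDegree} {t : ℝ} (ht : 0 < t) {α : ℝ} (hα : 0 < α) :
    (t : ℂ) * direction V j ∈ openSector (sectorAngle V j) α := by
  refine ⟨mul_ne_zero (Complex.ofReal_ne_zero.2 ht.ne') (direction_ne_zero j), ?_⟩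
  rw [exp_neg_sectorAngle, mul_inv_cancel_right₀ (direction_ne_zero j),
    Complex.arg_ofReal_of_nonneg ht.le, abs_zero]
  exact hα

theorem stretchesOut_of_ray_subset {F : Set ℂ} {j : Fin V.natDegree} (h : ray V j ⊆ F) :
    StretchesOut V F j := by
  have hα : 0 < Real.pi / (2 * V.natDegree) := by
    have : (0 : ℝ) < V.natDegree := Nat.cast_pos.2 (Fin.pos j)
    have := Real.pi_pos
    positivity
  refine ⟨Real.pi / (2 * V.natDegree) / 2, half_pos hα, 1, one_pos, fun r hr => ?_⟩
  have hr0 : 0 < r := one_pos.trans hr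
  refine ⟨r * direction V j, h ⟨r, hr0.le, rfl⟩, ?_, mem_sector_of_pos hr0 (by linarith)⟩
  rw [norm_mul, norm_direction, mul_one, Complex.norm_real, Real.norm_of_nonneg hr0.le]

theorem star_inter_sector {J : Set (Fin V.natDegree)} {j : Fin V.natDegree} (hj : j ∉ J) :
    star V J ∩ sector V j = ∅ := by
  rw [Set.eq_empty_iff_forall_notMem]
  rintro z ⟨hz, hzs⟩
  obtain ⟨k, hk, t, ht, rfl⟩ := Set.mem_iUnion₂.1 hz
  have ht0 : 0 < t := by
    refine lt_of_le_of_ne ht fun h => hzs.1 ?_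
    simp [← h]
  have hα : 0 < Real.pi / (2 * V.natDegree) := by
    have : (0 : ℝ) < V.natDegree := Nat.cast_pos.2 (Fin.pos j)
    have := Real.pi_pos
    positivity
  have hks : (t : ℂ) * direction V k ∈ sector V k := mem_sector_of_pos ht0 hα
  exact hj (eq_of_rootBranch_eq hzs hks rfl ▸ hk)

theorem isPreconnected_star (J : Set (Fin V.natDegree)) : IsPreconnected (star V J) := by
  refine isPreconnected_of_forall 0 fun z hz => ?_
  obtain ⟨j, hj, hz⟩ := Set.mem_iUnion₂.1 hz
  refine ⟨ray V j, Set.subset_biUnion_of_mem (u := fun j => ray V j) hj, zero_mem_ray j, hz, ?_⟩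
  exact isPreconnected_Ici.image _ (by fun_prop)

theorem components_eq_singleton {Γ : Set ℂ} (hΓ : IsPreconnected Γ) (hne : Γ.Nonempty) :
    components Γ = {Γ} := by
  ext C
  constructor
  · rintro ⟨x, hx, rfl⟩
    exact hΓ.connectedComponentIn hx
  · rintro rfl
    obtain ⟨x, hx⟩ := hne
    exact ⟨x, hx, (hΓ.connectedComponentIn hx).symm⟩

/-- All rays pass through `0`, so there is a single component, which serves every non-singleton
block at once. -/
theorem isAdmissible_star (P : Finpartition (Finset.univ : Finset (Fin V.natDegree)))
    (hP₀ : (nonSingletons P).Nonempty) :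
    IsAdmissible V P (star V {j | ∃ A ∈ nonSingletons P, j ∈ A}) := by
  set J : Set (Fin V.natDegree) := {j | ∃ A ∈ nonSingletons P, j ∈ A} with hJ
  obtain ⟨A₀, hA₀⟩ := hP₀
  obtain ⟨hA₀P, hcard⟩ := Finset.mem_filter.1 hA₀
  have h1 : 1 < A₀.card := by
    have := Finset.card_pos.2 (P.nonempty_of_mem_parts hA₀P)
    omega
  obtain ⟨j, hj, k, hk, hjk⟩ := Finset.one_lt_card.1 h1
  have hsub : ∀ {i}, i ∈ J → ray V i ⊆ star V J := fun {i} hi =>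
    Set.subset_biUnion_of_mem (u := fun j => ray V j) hi
  have hjJ : j ∈ J := ⟨A₀, hA₀, hj⟩
  have hkJ : k ∈ J := ⟨A₀, hA₀, hk⟩
  have hcomp : components (star V J) = {star V J} :=
    components_eq_singleton (isPreconnected_star J) ⟨0, hsub hjJ (zero_mem_ray j)⟩
  refine ⟨⟨ray V '' J, (Set.toFinite J).image _, ?_, ?_⟩, ?_, ?_, ?_, ?_, ?_⟩
  · rintro _ ⟨i, -, rfl⟩
    exact isC1JordanArc_ray i
  · rw [Set.sUnion_image, star]
  · rw [hcomp, Set.encard_singleton, ← Nat.cast_one, Nat.cast_le]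
    exact Finset.card_pos.2 ⟨A₀, hA₀⟩
  · intro C hC hb
    rw [hcomp, Set.mem_singleton_iff] at hC
    subst hC
    obtain ⟨R, hR⟩ := hb.exists_norm_le
    have := hR _ (hsub hjJ ⟨|R| + 1, by simp; positivity, rfl⟩)
    rw [norm_mul, norm_direction, mul_one, Complex.norm_real,
      Real.norm_of_nonneg (by positivity)] at this
    linarith [le_abs_self R]
  · intro C hC
    rw [hcomp, Set.mem_singleton_iff] at hC
    subst hC
    exact ⟨j, k, hjk, stretchesOut_of_ray_subset (hsub hjJ), stretchesOut_of_ray_subset (hsub hkJ)⟩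
  · intro A hA
    refine ⟨star V J, hcomp ▸ rfl, fun i hi => stretchesOut_of_ray_subset (hsub ⟨A, hA, hi⟩)⟩
  · intro A hA hAs
    refine ⟨1, one_pos, fun i hi => ?_⟩
    have hiJ : i ∉ J := by
      rintro ⟨B, hB, hiB⟩
      exact hAs (P.eq_of_mem_parts hA (Finset.mem_filter.1 hB).1 hi hiB ▸ hB)
    refine Set.subset_eq_empty ?_ (star_inter_sector hiJ)
    exact Set.inter_subset_inter_right _ Set.sdiff_subset

theorem exists_le_setEnergy_star (hV : 2 ≤ V.natDegree) (J : Set (Fin V.natDegree)) :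
    ∃ C : ℝ, ((-C : ℝ) : EReal) ≤ setEnergy V (star V J) := by
  obtain ⟨C, hC⟩ := exists_forall_log_le_field hV
  refine ⟨C, le_setEnergy V fun z hz => hC z ?_⟩
  obtain ⟨j, -, t, ht, rfl⟩ := Set.mem_iUnion₂.1 hz
  rw [mul_pow, mul_left_comm, leadingCoeff_mul_direction_pow, norm_mul, norm_direction, mul_one,
    Complex.norm_real, Real.norm_of_nonneg ht, ← Complex.ofReal_pow, ← Complex.ofReal_mul,
    Complex.ofReal_re, mul_comm]

end Star

/-! ### Upper bounds for the energy of contours -/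

section UpperBounds

variable {V : ℂ[X]} {P : Finpartition (Finset.univ : Finset (Fin V.natDegree))}

/-- An admissible contour that enters the forbidden region has energy at most `-M`. -/
theorem setEnergy_le_of_mem_forbidden {Γ : Set ℂ} (hΓ : IsAdmissible V P Γ) {M : ℝ} {z : ℂ}
    (hz : z ∈ Γ) (hzM : z ∈ forbidden V M) : setEnergy V Γ ≤ ((-M : ℝ) : EReal) := by
  have hC : connectedComponentIn Γ z ∈ components Γ := ⟨z, hz, rfl⟩
  refine setEnergy_le_of_circles V hΓ.isClosed z (a := 0) (fun r hr => ?_) fun w hw => ?_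
  · obtain ⟨x, hx, hxr⟩ := IsPreconnected.exists_norm_sub_eq isPreconnected_connectedComponentIn
      (hΓ.unbounded _ hC) (mem_connectedComponentIn hz) z (r := r) (by simpa using hr.1)
    exact ⟨x, connectedComponentIn_subset _ _ hx, hxr⟩
  · rw [zero_add] at hw
    -- If `φ` rose above `-M` in the disc, the level set would come within distance 8 of `z`.
    by_contra! hlt
    obtain ⟨x, hx, hxM⟩ := (convex_closedBall z 8).isPreconnected.intermediate_value
      (Metric.mem_closedBall_self (by norm_num)) hw (continuous_field V).continuousOn
      ⟨hzM.1.le, hlt.le⟩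
    have h1 : Metric.infDist z {w | field V w = -M} ≤ dist z x := Metric.infDist_le_dist_of_mem hxM
    have h2 := hzM.2
    rw [Metric.mem_closedBall, dist_comm] at hx
    linarith

/-- The contours that avoid the forbidden region meet every circle of sufficiently large radius,
uniformly in the contour. -/
theorem exists_forall_contoursM_meets_circles (hV : 2 ≤ V.natDegree)
    (hP₀ : (nonSingletons P).Nonempty) (M : ℝ) :
    ∃ R : ℝ, ∀ Γ ∈ contoursM V P M, ∀ r ≥ R, (Γ ∩ Metric.sphere 0 r).Nonempty := by
  obtain ⟨R, hR0, hR⟩ := exists_forall_mem_forbidden hV M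
  refine ⟨R, fun Γ hΓ r hr => ?_⟩
  obtain ⟨hadm, hdisj⟩ := hΓ
  obtain ⟨A, hA⟩ := hP₀
  obtain ⟨C, hC, -⟩ := hadm.blocks A hA
  obtain ⟨j, k, hjk, hCj, hCk⟩ := hadm.two_sectors C hC
  have hub := hadm.unbounded C hC
  obtain ⟨x₀, hx₀, rfl⟩ := hC
  obtain ⟨z, hzC, hz⟩ := hCj.exists_mem_sector
  obtain ⟨w, hwC, hw⟩ := hCk.exists_mem_sector
  -- A component that stayed outside the disc of radius `R` would avoid the rays separating the
  -- sectors, and so could not reach two of them.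
  obtain ⟨x, hx, hxR⟩ : ∃ x ∈ connectedComponentIn Γ x₀, ‖x‖ < R := by
    by_contra! hcon
    refine hjk (sector_unique_of_isPreconnected isPreconnected_connectedComponentIn
      (fun y hy => ?_) hzC hwC hz hw)
    by_contra hys
    exact Set.eq_empty_iff_forall_notMem.1 hdisj y
      ⟨connectedComponentIn_subset _ _ hy, hR y (hcon y hy) hys⟩
  obtain ⟨y, hy, hyr⟩ := IsPreconnected.exists_norm_sub_eq isPreconnected_connectedComponentIn
    hub hx 0 (r := r) (by rw [sub_zero]; exact hxR.le.trans hr)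
  exact ⟨y, connectedComponentIn_subset _ _ hy, by rwa [mem_sphere_iff_norm]⟩

theorem exists_setEnergy_closureM_le (hV : 2 ≤ V.natDegree) (hP₀ : (nonSingletons P).Nonempty)
    (M : ℝ) : ∃ B : ℝ, ∀ F ∈ closureM V P M, setEnergy V F ≤ (B : EReal) := by
  obtain ⟨R, hR⟩ := exists_forall_contoursM_meets_circles hV hP₀ M
  obtain ⟨B, hB⟩ := (isCompact_closedBall (0 : ℂ) (R + 8)).exists_bound_of_continuousOn
    (continuous_field V).continuousOn
  refine ⟨B, fun F hF => setEnergy_le_of_circles V hF.1 0 (a := R) (fun r hr => ?_) fun z hz =>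
    (le_abs_self _).trans (hB z hz)⟩
  -- As `R` does not depend on the contour, each fixed circle meets all the approximating contours
  -- and, being compact, also their limit.
  obtain ⟨z, hzF, hzr⟩ := exists_mem_of_sphereHausdorff hF.1 (isCompact_sphere (0 : ℂ) r)
    fun ε hε => by
      obtain ⟨Γ, hΓ, hlt⟩ := hF.2 ε hε
      exact ⟨Γ, hR Γ hΓ r hr.1, hlt⟩
  exact ⟨z, hzF, by rwa [mem_sphere_iff_norm] at hzr⟩

theorem contoursM_subset_closureM (M : ℝ) : contoursM V P M ⊆ closureM V P M := by
  refine fun Γ hΓ => ⟨hΓ.1.isClosed, fun ε hε => ⟨Γ, hΓ, ?_⟩⟩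
  rwa [sphereHausdorff, Metric.hausdorffEDist_self]

end UpperBounds

end SCurve

end

theorem proposition5p1 (V : Polynomial ℂ) (hV : 2 ≤ V.natDegree)
    (P : Finpartition (Finset.univ : Finset (Fin V.natDegree)))
    (hP : SCurve.IsNoncrossing P) (hP₀ : (SCurve.nonSingletons P).Nonempty) :
    (⊥ : EReal) < (⨆ Γ ∈ SCurve.contours V P, SCurve.setEnergy V Γ) ∧
    ∀ M : ℝ, 0 < M →
      ((-M : ℝ) : EReal) < (⨆ Γ ∈ SCurve.contours V P, SCurve.setEnergy V Γ) →
      (⨆ Γ ∈ SCurve.contours V P \ SCurve.contoursM V P M, SCurve.setEnergy V Γ) <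
          (⨆ Γ ∈ SCurve.contoursM V P M, SCurve.setEnergy V Γ) ∧
        (⨆ Γ ∈ SCurve.contoursM V P M, SCurve.setEnergy V Γ) ≤
          (⨆ F ∈ SCurve.closureM V P M, SCurve.setEnergy V F) ∧
        (⨆ F ∈ SCurve.closureM V P M, SCurve.setEnergy V F) < ⊤ := by
  refine ⟨?_, fun M _ hM => ⟨?_, ?_, ?_⟩⟩
  · obtain ⟨C, hC⟩ := SCurve.exists_le_setEnergy_star hV
      {j | ∃ A ∈ SCurve.nonSingletons P, j ∈ A}
    exact (EReal.bot_lt_coe _).trans_le (hC.trans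
      (le_iSup₂_of_le _ (SCurve.isAdmissible_star P hP₀) le_rfl))
  · have hout : ∀ Γ ∈ SCurve.contours V P \ SCurve.contoursM V P M,
        SCurve.setEnergy V Γ ≤ ((-M : ℝ) : EReal) := by
      rintro Γ ⟨hΓ, hΓM⟩
      have hne : (Γ ∩ SCurve.forbidden V M).Nonempty :=
        Set.nonempty_iff_ne_empty.2 fun h => hΓM ⟨hΓ, h⟩
      obtain ⟨z, hz, hzM⟩ := hne
      exact SCurve.setEnergy_le_of_mem_forbidden hΓ hz hzM
    refine (iSup₂_le hout).trans_lt ?_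
    -- A contour with energy above `-M` cannot enter `Δ_M`; its own energy separates the two
    -- suprema.
    obtain ⟨Γ, hΓ⟩ := lt_iSup_iff.1 hM
    obtain ⟨hΓT, hlt⟩ := lt_iSup_iff.1 hΓ
    have hΓM : Γ ∈ SCurve.contoursM V P M := by
      by_contra hcon
      exact (hout Γ ⟨hΓT, hcon⟩).not_gt hlt
    exact hlt.trans_le (le_iSup₂_of_le Γ hΓM le_rfl)
  · exact biSup_mono fun Γ hΓ => SCurve.contoursM_subset_closureM M hΓ
  · obtain ⟨B, hB⟩ := SCurve.exists_setEnergy_closureM_le hV hP₀ M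
    exact (iSup₂_le hB).trans_lt (EReal.coe_lt_top B)
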